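/- **Theorem (Colorful Helly Theorem for Multi-piercing Boxes).** An axis-parallel box in $\mathbb{R}^d$ is a set $[\alpha_1,\beta_1]\times\dots\times[\alpha_d,\beta_d]$ with real $\alpha_j\le\beta_j$ for all $j$. A family $\mathcal{F}$ of subsets of $\mathbb{R}^d$ is $n$-pierceable if there is a set $A\subseteq\mathbb{R}^d$ with $|A|\le n$ such that $F\cap A\neq\emptyset$ for every $F\in\mathcal{F}$. Given families $\mathcal{F}_1,\dots,\mathcal{F}_m$, a tuple $(C_1,\dots,C_t)$ is a colorful $t$-tuple if there are pairwise distinct indices $i_1,\dots,i_t\in\{1,\dots,m\}$ with $C_j\in\mathcal{F}_{i_j}$ for all $j$; it is $n$-pierceable if the family $\{C_1,\dots,C_t\}$ is. For integers $d,n\ge 1$ let $h_c(d,n)$ be the smallest positive integer $h$ (if there is one) with the following property: whenever $\mathcal{F}_1,\dots,\mathcal{F}_h$ are nonempty (finite or infinite) families of axis-parallel boxes in $\mathbb{R}^d$ such that every colorful $h$-tuple is $n$-pierceable, there is an $i\in\{1,\dots,h\}$ such that $\mathcal{F}_i$ is $n$-pierceable. Then 1. $h_c(1,n)=n+1$ for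 every integer $n\ge 1$, and 2. $h_c(d,2)=3d$ for every integer $d\ge 1$. (In particular, these smallest integers exist.) -/

import Mathlib

/-- An axis-parallel box `[α₁, β₁] × ⋯ × [α_d, β_d]` in `ℝ^d`, with `α_j ≤ β_j` for all `j`. -/
def IsBox {d : ℕ} (B : Set (Fin d → ℝ)) : Prop :=
  ∃ α β : Fin d → ℝ, α ≤ β ∧ B = Set.Icc α β

/-- A family `𝓕` of subsets of `X` is `n`-pierceable if some set of at most `n` points of `X`
meets every member of `𝓕`. -/
def IsPierceable {X : Type*} (n : ℕ) (𝓕 : Set (Set X)) : Prop :=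
  ∃ A : Finset X, A.card ≤ n ∧ ∀ F ∈ 𝓕, (F ∩ (A : Set X)).Nonempty

/-- `(C 0, …, C (t - 1))` is a colorful `t`-tuple from the families `𝓕 0, …, 𝓕 (m - 1)`:
its entries are taken from pairwise different families. -/
def IsColorful {X : Type*} {m t : ℕ} (𝓕 : Fin m → Set (Set X)) (C : Fin t → Set X) : Prop :=
  ∃ i : Fin t → Fin m, Function.Injective i ∧ ∀ j, C j ∈ 𝓕 (i j)

/-- The colorful Helly property with `h` colors, for `n`-piercing boxes in `ℝ^d`: for any
nonempty (possibly infinite) families `𝓕 0, …, 𝓕 (h - 1)` of boxes, if every colorful `h`-tuple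
is `n`-pierceable, then some family `𝓕 i` is `n`-pierceable. -/
def ColorfulHelly (d n h : ℕ) : Prop :=
  ∀ 𝓕 : Fin h → Set (Set (Fin d → ℝ)),
    (∀ i, (𝓕 i).Nonempty) →
    (∀ i, ∀ B ∈ 𝓕 i, IsBox B) →
    (∀ C : Fin h → Set (Fin d → ℝ), IsColorful 𝓕 C → IsPierceable n (Set.range C)) →
    ∃ i, IsPierceable n (𝓕 i)

/-- `h = h_c(d, n)`: the smallest positive integer with the colorful Helly property. -/
def IsColorfulHellyNumber (d n h : ℕ) : Prop :=
  IsLeast {m : ℕ | 0 < m ∧ ColorfulHelly d n m} h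

/-!
Upper bounds. By compactness all families may be assumed finite, and one has to choose one box from
each family so that the chosen boxes are not `n`-pierceable, given that no family is.

For intervals, take an interval with the smallest right endpoint `r` among all families. In any
other family the intervals to the right of `r` are not `(n - 1)`-pierceable, and induction gives a
choice of such intervals that is not `(n - 1)`-pierceable either
(`exists_choice_not_isPierceable_interval`).

For two points in dimension `d`, use up `2 * d` of the families: for each coordinate `j`, choose a
box whose right endpoint `a j` in this coordinate is minimal among the families still present, and
one whose left endpoint `b j` is maximal (`exists_greedy_selection`). Then a pair of points that
pierces these boxes can be moved to a pair of opposite vertices of the box spanned by `a` and `b`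
without leaving any box of the remaining `d` families (`exists_corner`). The vertices correspond to
sign vectors in `(ℤ/2) ^ d`, and those sign vectors whose pair of opposite vertices pierces a given
box form an affine subspace. No sign vector serves all boxes of a remaining family, so some box of
the family cuts a given nonempty affine subspace properly and at least halves it. After `d` steps
at most one sign vector is left; as the solutions are closed under negation, there is none
(`exists_choice_ncard_mul_pow_le`, `colorfulHelly_two`).

Lower bounds. For intervals, let all families consist of the same `n + 1` points. For two points,
`2 * d` families of parallel slabs and `d - 1` families of boxes linking the first coordinate to
another one show that `3 * d - 1` colors do not suffice (`not_colorfulHelly_two`).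
-/

/-! ### Piercing by tuples, and compactness -/

theorem IsPierceable.mono {X : Type*} {n : ℕ} {𝓕 𝓖 : Set (Set X)} (h : 𝓕 ⊆ 𝓖)
    (hp : IsPierceable n 𝓖) : IsPierceable n 𝓕 :=
  let ⟨A, hA, hF⟩ := hp
  ⟨A, hA, fun F hF' => hF F (h hF')⟩

theorem isPierceable_empty {X : Type*} (n : ℕ) : IsPierceable n (∅ : Set (Set X)) :=
  ⟨∅, by simp, by simp⟩

theorem nonempty_of_not_isPierceable {X : Type*} {n : ℕ} {𝓕 : Set (Set X)}
    (h : ¬ IsPierceable n 𝓕) : 𝓕.Nonempty := by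
  rw [Set.nonempty_iff_ne_empty]
  rintro rfl
  exact h (isPierceable_empty n)

theorem isPierceable_iff_exists_fin {X : Type*} [Nonempty X] {n : ℕ} {𝓕 : Set (Set X)} :
    IsPierceable n 𝓕 ↔ ∃ a : Fin n → X, ∀ F ∈ 𝓕, ∃ k, a k ∈ F := by
  classical
  constructor
  · rintro ⟨A, hA, hF⟩
    obtain ⟨f⟩ : Nonempty (A ↪ Fin n) :=
      Function.Embedding.nonempty_of_card_le (by simpa using hA)
    refine ⟨Function.extend f Subtype.val fun _ => Classical.arbitrary X, fun F hF' => ?_⟩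
    obtain ⟨x, hxF, hxA⟩ := hF F hF'
    exact ⟨f ⟨x, hxA⟩, by rwa [f.injective.extend_apply]⟩
  · rintro ⟨a, ha⟩
    refine ⟨Finset.univ.image a, Finset.card_image_le.trans (by simp), fun F hF => ?_⟩
    obtain ⟨k, hk⟩ := ha F hF
    exact ⟨a k, hk, by simp⟩

theorem not_isPierceable_of_pairwise_disjoint {X : Type*} {n : ℕ} {𝓕 : Set (Set X)}
    {f : Fin (n + 1) → Set X} (hf : ∀ k, f k ∈ 𝓕) (hd : Pairwise fun k l => Disjoint (f k) (f l)) :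
    ¬ IsPierceable n 𝓕 := by
  rintro ⟨A, hA, hF⟩
  choose x hxf hxA using fun k => hF (f k) (hf k)
  obtain ⟨k, -, l, -, hkl, he⟩ := Finset.exists_ne_map_eq_of_card_lt_of_maps_to
    (s := Finset.univ) (t := A) (f := x) (by simp; omega) (fun k _ => hxA k)
  exact Set.disjoint_left.1 (hd hkl) (hxf k) (he ▸ hxf l)

/-- Compactness: take the piercing `n`-tuples of the finite subfamilies and pass to the limit along
an ultrafilter. A given compact member is pierced by one and the same coordinate of the tuple for
almost all finite subfamilies, so this coordinate converges to a point of that member. Coordinates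
that do not converge are not needed. -/
theorem isPierceable_of_forall_finite {X : Type*} [TopologicalSpace X] [T2Space X] [Nonempty X]
    {n : ℕ} {𝓕 : Set (Set X)} (hc : ∀ F ∈ 𝓕, IsCompact F)
    (hfin : ∀ 𝓖 ⊆ 𝓕, 𝓖.Finite → IsPierceable n 𝓖) : IsPierceable n 𝓕 := by
  classical
  have hfin' : ∀ G : Finset 𝓕, ∃ a : Fin n → X, ∀ F ∈ G, ∃ k, a k ∈ (F : Set X) := by
    intro G
    obtain ⟨a, ha⟩ := isPierceable_iff_exists_fin.1
      (hfin (Subtype.val '' (G : Set 𝓕)) (by rintro _ ⟨F, -, rfl⟩; exact F.2)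
        (G.finite_toSet.image _))
    exact ⟨a, fun F hF => ha F ⟨F, hF, rfl⟩⟩
  choose a ha using hfin'
  let U : Ultrafilter (Finset 𝓕) := Ultrafilter.of Filter.atTop
  have hU : (U : Filter (Finset 𝓕)) ≤ Filter.atTop := Ultrafilter.of_le _
  refine isPierceable_iff_exists_fin.2 ⟨fun k => if h : ∃ x,
    (U.map fun G => a G k : Filter X) ≤ nhds x then h.choose else Classical.arbitrary X, ?_⟩
  intro F hF
  have hev : ∀ᶠ G in (U : Filter (Finset 𝓕)), ∃ k, a G k ∈ F :=
    ((Filter.eventually_ge_atTop {⟨F, hF⟩}).filter_mono hU).mono fun G hG =>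
      ha G ⟨F, hF⟩ (hG (Finset.mem_singleton_self _))
  obtain ⟨k, hk⟩ : ∃ k, ∀ᶠ G in (U : Filter (Finset 𝓕)), a G k ∈ F := by
    by_contra! hcon
    have : ∀ᶠ G in (U : Filter (Finset 𝓕)), ∀ k, a G k ∉ F :=
      Filter.eventually_all.2 hcon
    obtain ⟨G, ⟨k, hk⟩, hG⟩ := (hev.and this).exists
    exact hG k hk
  obtain ⟨x, hxF, hx⟩ := (hc F hF).ultrafilter_le_nhds (U.map fun G => a G k)
    (Filter.le_principal_iff.2 hk)
  have hex : ∃ x, (U.map fun G => a G k : Filter X) ≤ nhds x := ⟨x, hx⟩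
  refine ⟨k, ?_⟩
  simp only [dif_pos hex]
  rwa [tendsto_nhds_unique (f := id) (Filter.tendsto_id'.2 hex.choose_spec)
    (Filter.tendsto_id'.2 hx)]

/-! ### Reduction to finite families and to arbitrary index types -/

theorem IsBox.isCompact {d : ℕ} {B : Set (Fin d → ℝ)} (h : IsBox B) : IsCompact B := by
  obtain ⟨α, β, -, rfl⟩ := h
  exact isCompact_Icc

/-- By compactness it suffices to treat finite families, none of which is `n`-pierceable. -/
theorem colorfulHelly_of_finite {d n h : ℕ}
    (H : ∀ 𝓕 : Fin h → Set (Set (Fin d → ℝ)), (∀ i, (𝓕 i).Finite) →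
      (∀ i, ∀ B ∈ 𝓕 i, IsBox B) → (∀ i, ¬ IsPierceable n (𝓕 i)) →
      ∃ C : Fin h → Set (Fin d → ℝ), (∀ i, C i ∈ 𝓕 i) ∧ ¬ IsPierceable n (Set.range C)) :
    ColorfulHelly d n h := by
  intro 𝓕 _ hbox hC
  by_contra! hcon
  have hG : ∀ i, ∃ 𝓖 ⊆ 𝓕 i, 𝓖.Finite ∧ ¬ IsPierceable n 𝓖 := by
    intro i
    by_contra! hG
    exact hcon i (isPierceable_of_forall_finite (fun F hF => (hbox i F hF).isCompact) hG)
  choose 𝓖 hsub hfin hnp using hG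
  obtain ⟨C, hC', hCn⟩ := H 𝓖 hfin (fun i B hB => hbox i B (hsub i hB)) hnp
  exact hCn (hC C ⟨id, Function.injective_id, fun j => hsub j (hC' j)⟩)

/-- A counterexample with at least `m` colors gives one with exactly `m` colors, since colorful
tuples from fewer families extend to colorful tuples from all families. -/
theorem not_colorfulHelly_of_le_card {d n m : ℕ} {ι : Type*} [Fintype ι]
    (hm : m ≤ Fintype.card ι) (𝓕 : ι → Set (Set (Fin d → ℝ)))
    (hbox : ∀ i, ∀ B ∈ 𝓕 i, IsBox B) (hnp : ∀ i, ¬ IsPierceable n (𝓕 i))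
    (hC : ∀ C : ι → Set (Fin d → ℝ), (∀ i, C i ∈ 𝓕 i) → IsPierceable n (Set.range C)) :
    ¬ ColorfulHelly d n m := by
  intro H
  obtain ⟨e⟩ : Nonempty (Fin m ↪ ι) := Function.Embedding.nonempty_of_card_le (by simpa using hm)
  obtain ⟨i, hi⟩ := H (𝓕 ∘ e) (fun i => nonempty_of_not_isPierceable (hnp _))
    (fun i => hbox _) fun C ⟨i, hi, hCi⟩ => by
      choose D hD using fun i => nonempty_of_not_isPierceable (hnp i)
      have hinj : Function.Injective (e ∘ i) := e.injective.comp hi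
      refine (hC (Function.extend (e ∘ i) C D) fun k => ?_).mono ?_
      · by_cases hk : ∃ j, (e ∘ i) j = k
        · obtain ⟨j, rfl⟩ := hk
          rw [hinj.extend_apply]
          exact hCi j
        · rw [Function.extend_apply' _ _ _ hk]
          exact hD k
      · rintro _ ⟨j, rfl⟩
        exact ⟨e (i j), hinj.extend_apply C D j⟩
  exact hnp _ hi

/-! ### Intervals on the line -/

/-- Among all members of all families take an interval with the smallest right endpoint `r`. In
every other family, the intervals avoiding `r` lie to the right of `r` and are not
`(n - 1)`-pierceable, so that induction applies to them. -/
theorem exists_choice_not_isPierceable_interval {ι : Type*}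
    (lo hi : Set (Fin 1 → ℝ) → Fin 1 → ℝ) (n : ℕ) :
    ∀ (s : Finset ι) (𝓕 : ι → Set (Set (Fin 1 → ℝ))), s.card = n + 1 →
      (∀ i ∈ s, (𝓕 i).Finite) → (∀ i ∈ s, ∀ B ∈ 𝓕 i, lo B ≤ hi B ∧ B = Set.Icc (lo B) (hi B)) →
      (∀ i ∈ s, ¬ IsPierceable n (𝓕 i)) →
      ∃ C : ι → Set (Fin 1 → ℝ), (∀ i ∈ s, C i ∈ 𝓕 i) ∧ ¬ IsPierceable n (C '' s) := by
  classical
  induction n with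
  | zero =>
    intro s 𝓕 hs _ _ hnp
    obtain ⟨i, rfl⟩ := Finset.card_eq_one.1 hs
    obtain ⟨B, hB⟩ := nonempty_of_not_isPierceable (hnp i (by simp))
    refine ⟨fun _ => B, by simpa using hB, ?_⟩
    rintro ⟨A, hA, hF⟩
    obtain ⟨x, -, hx⟩ := hF B (by simp)
    simp [Finset.card_eq_zero.1 (Nat.le_zero.1 hA)] at hx
  | succ n ih =>
    intro s 𝓕 hs hfin hbox hnp
    obtain ⟨B₀, hB₀, hmin⟩ := Set.exists_min_image (⋃ i ∈ s, 𝓕 i) (fun B => hi B 0)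
      (s.finite_toSet.biUnion hfin) (by
        obtain ⟨i, his⟩ : s.Nonempty := Finset.card_pos.1 (by omega)
        obtain ⟨B, hB⟩ := nonempty_of_not_isPierceable (hnp i his)
        exact ⟨B, Set.mem_biUnion his hB⟩)
    obtain ⟨i₀, hi₀, hB₀⟩ := Set.mem_iUnion₂.1 hB₀
    have hmem : ∀ i ∈ s, ∀ B ∈ 𝓕 i, ∀ x, x ∈ B ↔ lo B 0 ≤ x 0 ∧ x 0 ≤ hi B 0 := by
      intro i his B hB x
      conv_lhs => rw [(hbox i his B hB).2]
      simp [Pi.le_def]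
    obtain ⟨C, hC, hCn⟩ := ih (s.erase i₀) (fun i => {B ∈ 𝓕 i | hi B₀ 0 < lo B 0})
      (by rw [Finset.card_erase_of_mem hi₀]; omega)
      (fun i his => (hfin i (Finset.mem_of_mem_erase his)).subset (Set.sep_subset _ _))
      (fun i his B hB => hbox i (Finset.mem_of_mem_erase his) B hB.1) (by
        rintro i his ⟨A, hA, hF⟩
        have his := Finset.mem_of_mem_erase his
        refine hnp i his ⟨insert (hi B₀) A, (Finset.card_insert_le _ _).trans (by omega), ?_⟩
        intro B hB
        by_cases hlt : hi B₀ 0 < lo B 0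
        · exact (hF B ⟨hB, hlt⟩).mono (Set.inter_subset_inter_right _ (by simp))
        · exact ⟨hi B₀, (hmem i his B hB _).2
            ⟨not_lt.1 hlt, hmin B (Set.mem_biUnion his hB)⟩, by simp⟩)
    refine ⟨Function.update C i₀ B₀, fun i his => ?_, ?_⟩
    · by_cases hne : i = i₀
      · subst hne
        simpa using hB₀
      · rw [Function.update_of_ne hne]
        exact (hC i (Finset.mem_erase.2 ⟨hne, his⟩)).1
    · rintro ⟨A, hA, hF⟩
      obtain ⟨p, hp, hpA⟩ := hF B₀ ⟨i₀, hi₀, by simp⟩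
      -- The point of `A` in `B₀` lies to the left of all other chosen intervals.
      refine hCn ⟨A.erase p, by rw [Finset.card_erase_of_mem hpA]; omega, ?_⟩
      rintro _ ⟨i, his, rfl⟩
      have his' := Finset.mem_erase.1 his
      obtain ⟨q, hq, hqA⟩ := hF (C i) ⟨i, his'.2, Function.update_of_ne his'.1 _ _⟩
      refine ⟨q, hq, Finset.mem_coe.2 (Finset.mem_erase.2 ⟨?_, hqA⟩)⟩
      rintro rfl
      have h1 := ((hmem i his'.2 _ (hC i his).1 q).1 hq).1
      have h2 := ((hmem i₀ hi₀ _ hB₀ q).1 hp).2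
      exact absurd (hC i his).2 (not_lt.2 (h1.trans h2))

theorem colorfulHelly_one (n : ℕ) : ColorfulHelly 1 n (n + 1) := by
  refine colorfulHelly_of_finite fun 𝓕 hfin hbox hnp => ?_
  choose! lo hi hlohi using fun (B : Set (Fin 1 → ℝ)) (h : IsBox B) => h
  obtain ⟨C, hC, hCn⟩ := exists_choice_not_isPierceable_interval lo hi n Finset.univ 𝓕 (by simp)
    (fun i _ => hfin i) (fun i _ B hB => hlohi B (hbox i B hB)) (fun i _ => hnp i)
  exact ⟨C, fun i => hC i (Finset.mem_univ i), by simpa using hCn⟩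

theorem not_colorfulHelly_one {n m : ℕ} (hm : m ≤ n) : ¬ ColorfulHelly 1 n m := by
  refine not_colorfulHelly_of_le_card (ι := Fin n) (by simpa using hm)
    (fun _ => Set.range fun k : Fin (n + 1) => {fun _ => (k : ℝ)}) ?_ (fun _ => ?_) ?_
  · rintro _ _ ⟨k, rfl⟩
    exact ⟨_, _, le_rfl, (Set.Icc_self _).symm⟩
  · refine not_isPierceable_of_pairwise_disjoint (fun k => ⟨k, rfl⟩) fun k l hkl => ?_
    refine Set.disjoint_singleton.2 fun h => ?_
    exact hkl (Fin.ext (by exact_mod_cast congrFun h 0))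
  · intro C hC
    choose k hk using hC
    refine isPierceable_iff_exists_fin.2 ⟨fun i _ => (k i : ℝ), ?_⟩
    rintro _ ⟨i, rfl⟩
    exact ⟨i, by simp [← hk i]⟩

/-! ### Two points: extremal boxes -/

/-- Families can be used up one by one so that each of the functions `f k`, `k ∈ t`, has a chosen
element at which its value is minimal compared with all members of the unused families. -/
theorem exists_greedy_selection {ι τ β : Type*} [Nonempty β] (𝓕 : ι → Set β)
    (f : τ → β → ℝ) (t : Finset τ) :
    ∀ s : Finset ι, t.card ≤ s.card → (∀ i ∈ s, (𝓕 i).Finite) → (∀ i ∈ s, (𝓕 i).Nonempty) →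
      ∃ u ⊆ s, u.card = t.card ∧ ∃ C : ι → β, (∀ i ∈ u, C i ∈ 𝓕 i) ∧
        ∀ k ∈ t, ∃ i ∈ u, ∀ i' ∈ s, i' ∉ u → ∀ B ∈ 𝓕 i', f k (C i) ≤ f k B := by
  classical
  induction t using Finset.induction_on with
  | empty =>
    intro s _ _ _
    exact ⟨∅, by simp, by simp, fun _ => Classical.arbitrary β, by simp, by simp⟩
  | insert k t hk ih =>
    intro s hs hfin hne
    rw [Finset.card_insert_of_notMem hk] at hs
    obtain ⟨B₀, hB₀, hmin⟩ := Set.exists_min_image (⋃ i ∈ s, 𝓕 i) (f k)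
      (s.finite_toSet.biUnion hfin) (by
        obtain ⟨i, his⟩ : s.Nonempty := Finset.card_pos.1 (by omega)
        obtain ⟨B, hB⟩ := hne i his
        exact ⟨B, Set.mem_biUnion his hB⟩)
    obtain ⟨i₀, hi₀, hB₀⟩ := Set.mem_iUnion₂.1 hB₀
    obtain ⟨u, hus, hu, C, hC, hCmin⟩ := ih (s.erase i₀)
      (by rw [Finset.card_erase_of_mem hi₀]; omega)
      (fun i hi => hfin i (Finset.mem_of_mem_erase hi))
      (fun i hi => hne i (Finset.mem_of_mem_erase hi))
    have hi₀u : i₀ ∉ u := fun h => Finset.notMem_erase i₀ s (hus h)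
    have hne' : ∀ i ∈ u, i ≠ i₀ := fun i hi h => hi₀u (h ▸ hi)
    refine ⟨insert i₀ u, Finset.insert_subset hi₀ (hus.trans (Finset.erase_subset _ _)), ?_,
      Function.update C i₀ B₀, ?_, ?_⟩
    · rw [Finset.card_insert_of_notMem hi₀u, Finset.card_insert_of_notMem hk, hu]
    · intro i hi
      rcases Finset.mem_insert.1 hi with rfl | hi
      · simpa using hB₀
      · rw [Function.update_of_ne (hne' i hi)]
        exact hC i hi
    · intro l hl
      rcases Finset.mem_insert.1 hl with rfl | hl
      · refine ⟨i₀, by simp, fun i his _ B hB => ?_⟩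
        rw [Function.update_self]
        exact hmin B (Set.mem_biUnion his hB)
      · obtain ⟨i, hi, hle⟩ := hCmin l hl
        refine ⟨i, Finset.mem_insert_of_mem hi, fun i' his hiu B hB => ?_⟩
        rw [Finset.mem_insert, not_or] at hiu
        rw [Function.update_of_ne (hne' i hi)]
        exact hle i' (Finset.mem_erase.2 ⟨hiu.1, his⟩) hiu.2 B hB

/-! ### Two points: affine sets of sign vectors -/

/-- The affine combination `x + y + z` of vectors over the field with two elements. -/
def xor₃ {κ : Type*} (x y z : κ → Bool) : κ → Bool := fun j => (x j ^^ y j) ^^ z j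

/-- Affine subspaces (possibly empty) over the field with two elements: sets closed under
`x + y + z`. -/
def IsXorAffine {κ : Type*} (S : Set (κ → Bool)) : Prop :=
  ∀ x ∈ S, ∀ y ∈ S, ∀ z ∈ S, xor₃ x y z ∈ S

theorem IsXorAffine.inter {κ : Type*} {S T : Set (κ → Bool)} (hS : IsXorAffine S)
    (hT : IsXorAffine T) : IsXorAffine (S ∩ T) := fun x hx y hy z hz =>
  ⟨hS x hx.1 y hy.1 z hz.1, hT x hx.2 y hy.2 z hz.2⟩

/-- A proper affine subspace contains at most half of the points: for `s ∈ S \ T` and `t ∈ T`, the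
translation by `s + t` maps `T` into `S \ T`. -/
theorem IsXorAffine.two_mul_ncard_le {κ : Type*} [Finite κ] {S T : Set (κ → Bool)}
    (hS : IsXorAffine S) (hT : IsXorAffine T) (hTS : T ⊆ S) {s : κ → Bool} (hs : s ∈ S)
    (hsT : s ∉ T) : T.ncard * 2 ≤ S.ncard := by
  rcases T.eq_empty_or_nonempty with rfl | ⟨t, ht⟩
  · simp
  have key : T.ncard ≤ (S \ T).ncard := by
    refine Set.ncard_le_ncard_of_injOn (fun x => xor₃ x s t) (fun x hx => ?_) ?_ (Set.toFinite _)
    · refine ⟨hS x (hTS hx) s hs t (hTS ht), fun h => hsT ?_⟩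
      have := hT _ h x hx t ht
      convert this using 1
      funext j
      simp only [xor₃]
      cases x j <;> cases s j <;> cases t j <;> rfl
    · intro x _ y _ h
      funext j
      have := congrFun h j
      simpa [xor₃] using this
  have := Set.ncard_sdiff_add_ncard_of_subset hTS (Set.toFinite S)
  omega

/-- One member is chosen from each family so that few points satisfy all of them. No point
satisfies a whole family, so any nonempty affine set of points satisfying the members chosen so far
is cut properly by some member of the next family, and thus at least halved. -/
theorem exists_choice_ncard_mul_pow_le {ι κ β : Type*} [Fintype κ] [Nonempty β]
    (𝓕 : ι → Set β) (Sat : β → Set (κ → Bool)) (s : Finset ι)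
    (haff : ∀ i ∈ s, ∀ B ∈ 𝓕 i, IsXorAffine (Sat B)) (hex : ∀ i ∈ s, ∀ x, ∃ B ∈ 𝓕 i, x ∉ Sat B) :
    ∃ C : ι → β, (∀ i ∈ s, C i ∈ 𝓕 i) ∧ IsXorAffine {x | ∀ i ∈ s, x ∈ Sat (C i)} ∧
      {x | ∀ i ∈ s, x ∈ Sat (C i)}.ncard * 2 ^ s.card ≤ 2 ^ Fintype.card κ := by
  classical
  induction s using Finset.induction_on with
  | empty => exact ⟨fun _ => Classical.arbitrary β, by simp,
      fun _ _ _ _ _ _ => by simp, by simp [Set.ncard_univ]⟩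
  | insert i s his ih =>
    obtain ⟨C, hC, hS, hcard⟩ := ih (fun i hi => haff i (Finset.mem_insert_of_mem hi))
      fun i hi => hex i (Finset.mem_insert_of_mem hi)
    have hi := Finset.mem_insert_self i s
    have hset : ∀ B, {x | ∀ k ∈ insert i s, x ∈ Sat (Function.update C i B k)} =
        {x | ∀ k ∈ s, x ∈ Sat (C k)} ∩ Sat B := by
      intro B
      ext x
      have : ∀ k ∈ s, Function.update C i B k = C k := fun k hk =>
        Function.update_of_ne (ne_of_mem_of_not_mem hk his) _ _
      simp +contextual [and_comm, this]
    have hmem : ∀ B ∈ 𝓕 i, ∀ k ∈ insert i s, Function.update C i B k ∈ 𝓕 k := by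
      intro B hB k hk
      by_cases hki : k = i
      · subst hki
        simpa using hB
      · rw [Function.update_of_ne hki]
        exact hC k (Finset.mem_of_mem_insert_of_ne hk hki)
    -- If no point is left, any point serves to pick a member of the new family.
    obtain ⟨x, hx⟩ : ∃ x, ({x | ∀ k ∈ s, x ∈ Sat (C k)}.Nonempty →
        x ∈ {x | ∀ k ∈ s, x ∈ Sat (C k)}) := by
      by_cases hne : {x | ∀ k ∈ s, x ∈ Sat (C k)}.Nonempty
      · exact ⟨hne.some, fun _ => hne.some_mem⟩
      · exact ⟨fun _ => true, fun h => absurd h hne⟩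
    obtain ⟨B, hB, hxB⟩ := hex i hi x
    have hT := hS.inter (haff i hi B hB)
    refine ⟨Function.update C i B, hmem B hB, by rwa [hset], ?_⟩
    rw [hset, Finset.card_insert_of_notMem his, pow_succ', ← mul_assoc]
    refine (Nat.mul_le_mul_right _ ?_).trans hcard
    by_cases hne : {x | ∀ k ∈ s, x ∈ Sat (C k)}.Nonempty
    · exact hS.two_mul_ncard_le hT Set.inter_subset_left (hx hne) fun h => hxB h.2
    · rw [Set.not_nonempty_iff_eq_empty.1 hne]
      simp

theorem isXorAffine_pi_or_not {κ : Type*} (A : κ → Set Bool) :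
    IsXorAffine {x : κ → Bool | (∀ j, x j ∈ A j) ∨ ∀ j, (!x j) ∈ A j} := by
  have key : ∀ (T : Set Bool) (a b c : Bool), a ∈ T → b ∈ T → c ∈ T → ((a ^^ b) ^^ c) ∈ T := by
    intro T a b c
    cases a <;> cases b <;> cases c <;> simp +contextual
  -- An odd number of negations among `x`, `y`, `z` negates `x + y + z`.
  rintro x (hx | hx) y (hy | hy) z (hz | hz)
  · exact .inl fun j => key _ _ _ _ (hx j) (hy j) (hz j)
  · exact .inr fun j => by simpa [xor₃] using key _ _ _ _ (hx j) (hy j) (hz j)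
  · exact .inr fun j => by simpa [xor₃] using key _ _ _ _ (hx j) (hy j) (hz j)
  · exact .inl fun j => by simpa [xor₃] using key _ _ _ _ (hx j) (hy j) (hz j)
  · exact .inr fun j => by simpa [xor₃] using key _ _ _ _ (hx j) (hy j) (hz j)
  · exact .inl fun j => by simpa [xor₃] using key _ _ _ _ (hx j) (hy j) (hz j)
  · exact .inl fun j => by simpa [xor₃] using key _ _ _ _ (hx j) (hy j) (hz j)
  · exact .inr fun j => by simpa [xor₃] using key _ _ _ _ (hx j) (hy j) (hz j)

/-! ### Two points: the upper bound -/

/-- The vertex of the box spanned by `a` and `b` that is given by the sign vector `x`. -/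
def corner {d : ℕ} (a b : Fin d → ℝ) (x : Fin d → Bool) : Fin d → ℝ :=
  fun j => if x j then a j else b j

theorem isXorAffine_corner {d : ℕ} (a b α β : Fin d → ℝ) :
    IsXorAffine {x | corner a b x ∈ Set.Icc α β ∨ corner a b (fun j => !x j) ∈ Set.Icc α β} := by
  convert isXorAffine_pi_or_not
    fun j => {c : Bool | (if c then a j else b j) ∈ Set.Icc (α j) (β j)} using 1
  ext x
  simp only [Set.mem_ofPred_eq, Set.mem_Icc, Pi.le_def, corner, forall_and]

/-- If in each coordinate one of two points is `≤ a j` and one is `≥ b j`, then they can be moved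
to opposite corners of the box spanned by `a` and `b` without leaving any box `[α, β]` with
`a ≤ β` and `α ≤ b`. -/
theorem exists_corner {d : ℕ} {a b p q : Fin d → ℝ} (ha : ∀ j, p j ≤ a j ∨ q j ≤ a j)
    (hb : ∀ j, b j ≤ p j ∨ b j ≤ q j) :
    ∃ x : Fin d → Bool, ∀ α β : Fin d → ℝ, a ≤ β → α ≤ b →
      (p ∈ Set.Icc α β → corner a b x ∈ Set.Icc α β) ∧
      (q ∈ Set.Icc α β → corner a b (fun j => !x j) ∈ Set.Icc α β) := by
  have h : ∀ j, ∃ c : Bool, ∀ α β : ℝ, a j ≤ β → α ≤ b j →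
      (α ≤ p j ∧ p j ≤ β → α ≤ (if c then a j else b j) ∧ (if c then a j else b j) ≤ β) ∧
      (α ≤ q j ∧ q j ≤ β → α ≤ (if !c then a j else b j) ∧ (if !c then a j else b j) ≤ β) := by
    intro j
    -- If `b j ≤ a j`, then `[α j, β j]` contains both values and the sign is immaterial.
    rcases le_total (b j) (a j) with hba | hab
    · exact ⟨true, fun α β h1 h2 => ⟨fun _ => by simp; constructor <;> linarith,
        fun _ => by simp; constructor <;> linarith⟩⟩
    rcases le_or_gt (p j) (a j) with hp | hp
    · rcases hb j with hb' | hb'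
      all_goals
        exact ⟨true, fun α β h1 h2 => ⟨fun _ => by simp; constructor <;> linarith,
          fun _ => by simp; constructor <;> linarith⟩⟩
    · have hq := (ha j).resolve_left (not_le.2 hp)
      rcases hb j with hb' | hb'
      all_goals
        exact ⟨false, fun α β h1 h2 => ⟨fun _ => by simp; constructor <;> linarith,
          fun _ => by simp; constructor <;> linarith⟩⟩
  choose x hx using h
  refine ⟨x, fun α β hβ hα => ⟨fun hp => ⟨fun j => ?_, fun j => ?_⟩,
    fun hq => ⟨fun j => ?_, fun j => ?_⟩⟩⟩
  · exact ((hx j _ _ (hβ j) (hα j)).1 ⟨hp.1 j, hp.2 j⟩).1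
  · exact ((hx j _ _ (hβ j) (hα j)).1 ⟨hp.1 j, hp.2 j⟩).2
  · exact ((hx j _ _ (hβ j) (hα j)).2 ⟨hq.1 j, hq.2 j⟩).1
  · exact ((hx j _ _ (hβ j) (hα j)).2 ⟨hq.1 j, hq.2 j⟩).2

theorem colorfulHelly_two {d : ℕ} (hd : 1 ≤ d) : ColorfulHelly d 2 (3 * d) := by
  classical
  refine colorfulHelly_of_finite fun 𝓕 hfin hbox hnp => ?_
  choose! lo hi hlohi using fun (B : Set (Fin d → ℝ)) (h : IsBox B) => h
  have hIcc : ∀ i, ∀ B ∈ 𝓕 i, B = Set.Icc (lo B) (hi B) := fun i B hB => (hlohi B (hbox i B hB)).2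
  -- Use up `2 * d` families for boxes with extremal endpoints in each coordinate.
  obtain ⟨u, -, hu, C, hC, hmin⟩ := exists_greedy_selection 𝓕
    (fun (k : Fin d × Bool) B => if k.2 then -lo B k.1 else hi B k.1) Finset.univ Finset.univ
    (by simp; omega) (fun i _ => hfin i) (fun i _ => nonempty_of_not_isPierceable (hnp i))
  have hmin_hi : ∀ j, ∃ i ∈ u, ∀ i' ∉ u, ∀ B ∈ 𝓕 i', hi (C i) j ≤ hi B j := fun j => by
    simpa using hmin (j, false) (Finset.mem_univ _)
  have hmax_lo : ∀ j, ∃ i ∈ u, ∀ i' ∉ u, ∀ B ∈ 𝓕 i', lo B j ≤ lo (C i) j := fun j => by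
    simpa using hmin (j, true) (Finset.mem_univ _)
  choose ia hiau ha using hmin_hi
  choose ib hibu hb using hmax_lo
  let a : Fin d → ℝ := fun j => hi (C (ia j)) j
  let b : Fin d → ℝ := fun j => lo (C (ib j)) j
  -- The other `d` families are treated through the corners of the box spanned by `a` and `b`.
  obtain ⟨D, hD, -, hcard⟩ := exists_choice_ncard_mul_pow_le 𝓕
    (fun B => {x | corner a b x ∈ B ∨ corner a b (fun j => !x j) ∈ B}) uᶜ
    (fun i _ B hB => by
      rw [hIcc i B hB]
      exact isXorAffine_corner a b _ _)
    (fun i _ x => by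
      by_contra! hcon
      refine hnp i (isPierceable_iff_exists_fin.2
        ⟨![corner a b x, corner a b fun j => !x j], fun B hB => ?_⟩)
      rcases hcon B hB with h | h
      · exact ⟨0, h⟩
      · exact ⟨1, h⟩)
  have hcompl : uᶜ.card = d := by
    rw [Finset.card_compl, hu]
    simp
    omega
  rw [hcompl, Fintype.card_fin] at hcard
  refine ⟨fun i => if i ∈ u then C i else D i, fun i => ?_, fun hp => ?_⟩
  · by_cases hi : i ∈ u
    · simpa [hi] using hC i hi
    · simpa [hi] using hD i (by simpa using hi)
  obtain ⟨p, hp⟩ := isPierceable_iff_exists_fin.1 hp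
  have hpC : ∀ i ∈ u, p 0 ∈ C i ∨ p 1 ∈ C i := fun i hi => by
    simpa [hi, Fin.exists_fin_two] using hp _ ⟨i, rfl⟩
  have hpD : ∀ i ∉ u, p 0 ∈ D i ∨ p 1 ∈ D i := fun i hi => by
    simpa [hi, Fin.exists_fin_two] using hp _ ⟨i, rfl⟩
  obtain ⟨x, hx⟩ := exists_corner (a := a) (b := b) (p := p 0) (q := p 1)
    (fun j => (hpC _ (hiau j)).imp (fun h => ((hIcc _ _ (hC _ (hiau j))).subset h).2 j)
      fun h => ((hIcc _ _ (hC _ (hiau j))).subset h).2 j)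
    (fun j => (hpC _ (hibu j)).imp (fun h => ((hIcc _ _ (hC _ (hibu j))).subset h).1 j)
      fun h => ((hIcc _ _ (hC _ (hibu j))).subset h).1 j)
  have hxS : ∀ i ∈ uᶜ, corner a b x ∈ D i ∨ corner a b (fun j => !x j) ∈ D i := fun i hmem => by
    have hDi := hD i hmem
    have hiu : i ∉ u := by simpa using hmem
    have := hx (lo (D i)) (hi (D i)) (fun j => ha j i hiu _ hDi) (fun j => hb j i hiu _ hDi)
    rw [← hIcc i _ hDi] at this
    exact (hpD i hiu).imp this.1 this.2
  -- With `x` also its negation is a solution, but there is room for one solution only.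
  have hle : {x : Fin d → Bool | ∀ i ∈ uᶜ,
      corner a b x ∈ D i ∨ corner a b (fun j => !x j) ∈ D i}.ncard ≤ 1 := by
    by_contra! h
    have := Nat.mul_le_mul_right (2 ^ d) h
    have := this.trans hcard
    have := Nat.two_pow_pos d
    omega
  have heq := (Set.ncard_le_one (Set.toFinite _)).1 hle x hxS (fun j => !x j)
    (fun i hi => by simpa [or_comm] using hxS i hi)
  simpa using congrFun heq ⟨0, hd⟩

/-! ### Two points: the lower bound -/

theorem isBox_pi {d : ℕ} {I : Fin d → Set ℝ} (h : ∀ j, ∃ a b, a ≤ b ∧ I j = Set.Icc a b) :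
    IsBox (Set.univ.pi I) := by
  choose a b hab hI using h
  exact ⟨a, b, hab, by rw [← Set.pi_univ_Icc, funext hI]⟩

/-- Three pairwise disjoint intervals in `[0, 3]`. -/
def slabInterval (k : Fin 3) : Set ℝ := Set.Icc (![0, 1, 3] k) (![0, 2, 3] k)

/-- The interval `[0, 1]` for `false` and `[2, 3]` for `true`. -/
def halfInterval (c : Bool) : Set ℝ := Set.Icc (if c then 2 else 0) (if c then 3 else 1)

/-- The points of `[0, 3] ^ d` whose coordinate `j` lies in `slabInterval k`. -/
def slab {d : ℕ} (j : Fin d) (k : Fin 3) : Set (Fin d → ℝ) :=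
  Set.univ.pi (Function.update (fun _ => Set.Icc 0 3) j (slabInterval k))

/-- Three boxes, given by conditions on the coordinates `0` and `i + 1` of a point of
`[0, 3] ^ (m + 1)`: both lie in `[0, 1]`, or the second only is moved to `[2, 3]`, or the first
only is. -/
def starBox {m : ℕ} (i : Fin m) (k : Fin 3) : Set (Fin (m + 1) → ℝ) :=
  Set.univ.pi (Fin.cons (halfInterval (decide (k = 2)))
    (Function.update (fun _ => Set.Icc 0 3) i (halfInterval (decide (k = 1)))))

theorem slabInterval_disjoint {k l : Fin 3} (h : k ≠ l) :
    Disjoint (slabInterval k) (slabInterval l) := by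
  rw [Set.disjoint_left]
  intro x
  fin_cases k <;> fin_cases l <;> simp [slabInterval] at h ⊢ <;> intros <;> linarith

theorem halfInterval_disjoint {c e : Bool} (h : c ≠ e) :
    Disjoint (halfInterval c) (halfInterval e) := by
  rw [Set.disjoint_left]
  intro x
  cases c <;> cases e <;> simp [halfInterval] at h ⊢ <;> intros <;> linarith

theorem isBox_slab {d : ℕ} (j : Fin d) (k : Fin 3) : IsBox (slab j k) := by
  refine isBox_pi fun i => ?_
  rw [Function.update_apply]
  split_ifs
  · exact ⟨_, _, by fin_cases k <;> norm_num, rfl⟩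
  · exact ⟨0, 3, by norm_num, rfl⟩

theorem isBox_starBox {m : ℕ} (i : Fin m) (k : Fin 3) : IsBox (starBox i k) := by
  have h : ∀ c, ∃ a b : ℝ, a ≤ b ∧ halfInterval c = Set.Icc a b := fun c =>
    ⟨_, _, by cases c <;> norm_num, rfl⟩
  refine isBox_pi (Fin.cases (h _) fun j => ?_)
  rw [Fin.cons_succ, Function.update_apply]
  split_ifs
  · exact h _
  · exact ⟨0, 3, by norm_num, rfl⟩

theorem slab_disjoint {d : ℕ} (j : Fin d) {k l : Fin 3} (h : k ≠ l) :
    Disjoint (slab j k) (slab j l) :=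
  Set.disjoint_univ_pi.2 ⟨j, by simpa using slabInterval_disjoint h⟩

theorem starBox_disjoint {m : ℕ} (i : Fin m) {k l : Fin 3} (h : k ≠ l) :
    Disjoint (starBox i k) (starBox i l) := by
  refine Set.disjoint_univ_pi.2 ?_
  by_cases h2 : decide (k = 2) = decide (l = 2)
  · refine ⟨i.succ, ?_⟩
    simp only [Fin.cons_succ, Function.update_self]
    refine halfInterval_disjoint ?_
    revert h h2
    decide +revert
  · exact ⟨0, by simpa using halfInterval_disjoint h2⟩

theorem halfInterval_subset (c : Bool) : halfInterval c ⊆ Set.Icc 0 3 := by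
  intro x
  cases c <;> simp [halfInterval] <;> intros <;> constructor <;> linarith

/-- Any two of the three intervals are pierced by a point of `[0, 1]` and a point of `[2, 3]`. -/
theorem exists_pair_mem_slabInterval (k l : Fin 3) : ∃ v : Bool → ℝ,
    (∀ c, v c ∈ halfInterval c) ∧ (∃ c, v c ∈ slabInterval k) ∧ ∃ c, v c ∈ slabInterval l := by
  -- An endpoint `0` or `3` is used if one of the outer intervals requires it.
  let v : Bool → ℝ := fun c =>
    if c then if k = 2 ∨ l = 2 then 3 else 2 else if k = 0 ∨ l = 0 then 0 else 1
  refine ⟨v, ?_, ?_, ?_⟩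
  · rw [Bool.forall_bool]
    constructor <;> simp only [v, halfInterval] <;> split_ifs <;> norm_num at *
  all_goals
    rw [Bool.exists_bool]
    fin_cases k <;> fin_cases l <;> simp [v, slabInterval]

/-- In each coordinate, two families of three disjoint slabs; for each coordinate other than the
first, one family of three disjoint boxes that link this coordinate to the first. A choice of two
slabs in each coordinate leaves all `2 ^ d` ways of joining the coordinates of the two piercing
points, and the chosen linking boxes can be served one after the other, as the links form a
star. -/
theorem not_colorfulHelly_two {d m : ℕ} (hm : m < 3 * d) : ¬ ColorfulHelly d 2 m := by
  obtain ⟨r, rfl⟩ : ∃ r, d = r + 1 := ⟨d - 1, by omega⟩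
  refine not_colorfulHelly_of_le_card (ι := (Fin (r + 1) × Bool) ⊕ Fin r) (by simp; omega)
    (Sum.elim (fun j => Set.range (slab j.1)) fun i => Set.range (starBox i)) ?_ ?_ fun C hC => ?_
  · rintro (j | i) _ ⟨k, rfl⟩
    · exact isBox_slab _ _
    · exact isBox_starBox _ _
  · rintro (j | i)
    · exact not_isPierceable_of_pairwise_disjoint (f := slab j.1) (fun k => ⟨k, rfl⟩)
        fun _ _ => slab_disjoint _
    · exact not_isPierceable_of_pairwise_disjoint (f := starBox i) (fun k => ⟨k, rfl⟩)
        fun _ _ => starBox_disjoint _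
  choose k hk using fun j => hC (.inl j)
  choose l hl using fun i => hC (.inr i)
  choose v hv hv₁ hv₂ using fun j => exists_pair_mem_slabInterval (k (j, false)) (k (j, true))
  -- The sign vector of the first point; the second point has the opposite sign vector.
  let x : Fin (r + 1) → Bool := Fin.cons false fun i => decide (l i ≠ 0)
  let p : Bool → Fin (r + 1) → ℝ := fun c j => v j (x j ^^ c)
  have hp : ∀ c j, p c j ∈ Set.Icc 0 3 := fun c j => halfInterval_subset _ (hv j _)
  have hslab : ∀ j t, (∃ c, v j c ∈ slabInterval t) → ∃ c, p c ∈ slab j t := by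
    rintro j t ⟨c, hc⟩
    refine ⟨x j ^^ c, fun i _ => ?_⟩
    rw [Function.update_apply]
    split_ifs with hij
    · subst hij
      simpa [p] using hc
    · exact hp _ _
  have hstar : ∀ i, p (decide (l i = 2)) ∈ starBox i (l i) := by
    intro i j _
    refine Fin.cases ?_ (fun j => ?_) j
    · simpa [p, x] using hv 0 (decide (l i = 2))
    · rw [Fin.cons_succ, Function.update_apply]
      split_ifs with hij
      · subst hij
        have : (decide (l j ≠ 0) ^^ decide (l j = 2)) = decide (l j = 1) := by
          generalize l j = t
          decide +revert
        rw [← this]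
        exact hv _ _
      · exact hp _ _
  refine isPierceable_iff_exists_fin.2 ⟨![p false, p true], ?_⟩
  rintro _ ⟨i | i, rfl⟩
  · have : ∃ c, p c ∈ slab i.1 (k i) := by
      obtain ⟨j, c⟩ := i
      cases c
      · exact hslab j _ (hv₁ j)
      · exact hslab j _ (hv₂ j)
    rw [hk i] at this
    simpa [Fin.exists_fin_two] using this
  · have : ∃ c, p c ∈ starBox i (l i) := ⟨_, hstar i⟩
    rw [hl i] at this
    simpa [Fin.exists_fin_two] using this

theorem mainTheorem2 :
    (∀ n : ℕ, 1 ≤ n → IsColorfulHellyNumber 1 n (n + 1)) ∧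
    (∀ d : ℕ, 1 ≤ d → IsColorfulHellyNumber d 2 (3 * d)) := by
  refine ⟨fun n _ => ⟨⟨by omega, colorfulHelly_one n⟩, fun m hm => ?_⟩,
    fun d hd => ⟨⟨by omega, colorfulHelly_two hd⟩, fun m hm => ?_⟩⟩
  · by_contra h
    exact not_colorfulHelly_one (by omega) hm.2
  · by_contra h
    exact not_colorfulHelly_two (by omega) hm.2
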